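/- Let $f:\mathbb{R}^2\to\mathbb{R}^2$ be of class $C^1$ and let $x_0$ be a singular point of the planar system $\dot x=f(x)$, that is, $f(x_0)=0$. Suppose that a neighbourhood of $x_0$ is divided, by $n\ge 1$ arcs that issue from $x_0$ and are otherwise pairwise disjoint, into $n$ closed topological sectors with vertex $x_0$, arranged cyclically around $x_0$, each lying between two consecutive arcs (its sides) and any two distinct ones meeting only along common sides; for $n=1$ the single sector is a disc cut along one arc. If $n$ is odd, then the $n$ sectors are not all hyperbolic. Here a sector $S$ is called hyperbolic if it is topologically equivalent to the sector $Q=[0,1]^2$ of the linear saddle $\dot u=u,\ \dot v=-v$: there is a continuous map $\varphi$ from $Q$ onto $S$ with $\varphi(0,0)=x_0$, carrying the two sides $[0,1]\times\{0\}$ and $\{0\}\times[0,1]$ of $Q$ onto the two sides of $S$, injective except that points of the two sides of $Q$ may be identified with each other if the sides of $S$ coincide (so $\varphi$ is a homeomorphism if they do not), such that $\varphi$ maps each trajectory in $Q$ onto a trajectory of $\dot x=f(x)$ in $S$, regardless of the direction of the flow. The trajectory in a set through a point $p$ consists of the points joined to $p$ by a solution arc that stays in the set. In particular ($n=3$), no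 singular point is a ``Delta'', that is, has a neighbourhood divided in this way into exactly three sectors, all of them hyperbolic. -/

import Mathlib

open Set Topology

/-- The part in `S` of the trajectory through `p` of the system `ẋ = f x`: all the points that are
joined to `p`, forwards or backwards in time, by a solution that stays in `S`. -/
def trajectoryIn {E : Type*} [NormedAddCommGroup E] [NormedSpace ℝ E]
    (f : E → E) (S : Set E) (p : E) : Set E :=
  {q | ∃ (γ : ℝ → E) (a b : ℝ), IsIntegralCurveOn γ (fun _ => f) (uIcc a b) ∧
    γ a = p ∧ γ b = q ∧ ∀ t ∈ uIcc a b, γ t ∈ S}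

/-- The model of a closed sector with vertex `(0, 0)`: the unit square. -/
def modelSector : Set (ℝ × ℝ) := Icc 0 1 ×ˢ Icc 0 1

/-- The first side of the model sector, on the horizontal axis. -/
def modelSide₀ : Set (ℝ × ℝ) := Icc 0 1 ×ˢ {0}

/-- The second side of the model sector, on the vertical axis. -/
def modelSide₁ : Set (ℝ × ℝ) := {0} ×ˢ Icc 0 1

/-- The linear saddle `u̇ = u`, `v̇ = -v`, whose trajectories in the model sector are the vertex,
the two sides without the vertex, and the arcs of the hyperbolas `u v = c`, `0 < c ≤ 1`. -/
def modelSaddle : ℝ × ℝ → ℝ × ℝ := fun p => (p.1, -p.2)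

/-- `φ` exhibits `S` as a closed topological sector with vertex `x₀`, whose sides are the arcs `A`
and `B` issuing from `x₀`. The map `φ` is injective, except that a point of the first side may
coincide with a point of the second one; this allows the single sector that is left when a disc
is cut along one arc (there `A = B`). When `A` and `B` meet only in `x₀`, the map `φ` is injective
on the compact model sector, hence a homeomorphism onto `S`. -/
structure IsSectorChart {X : Type*} [TopologicalSpace X] (φ : ℝ × ℝ → X) (x₀ : X)
    (S A B : Set X) : Prop where
  continuousOn : ContinuousOn φ modelSector
  map_vertex : φ (0, 0) = x₀
  image_sector : φ '' modelSector = S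
  image_side₀ : φ '' modelSide₀ = A
  image_side₁ : φ '' modelSide₁ = B
  injOn₀ : InjOn φ (modelSector \ (modelSide₁ \ {(0, 0)}))
  injOn₁ : InjOn φ (modelSector \ (modelSide₀ \ {(0, 0)}))

/-- A division of a neighbourhood of `x₀` into `n` closed sectors, in cyclic order around `x₀`,
by `n` arcs `side i` that issue from `x₀` and are otherwise disjoint: the sector number `i` lies
between `side i` and `side (i + 1)`, and distinct sectors meet only along common sides. (Used
for `n ≥ 1` only, where `ZMod n` has `n` elements.) -/
structure SectorDecomposition {X : Type*} [TopologicalSpace X] (x₀ : X) (n : ℕ) where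
  side : ZMod n → Set X
  sector : ZMod n → Set X
  isSector : ∀ i, ∃ φ, IsSectorChart φ x₀ (sector i) (side i) (side (i + 1))
  side_inter_side : ∀ i j, i ≠ j → side i ∩ side j = {x₀}
  sector_inter_sector : ∀ i j, i ≠ j → sector i ∩ sector j ⊆ side i ∪ side (i + 1)
  iUnion_sector_mem_nhds : (⋃ i, sector i) ∈ 𝓝 x₀

/-- The sector `S` with vertex `x₀` and sides `A` and `B` is hyperbolic for `ẋ = f x`: it is
topologically equivalent to a quadrant of the linear saddle, by a map that takes each trajectory in
the model onto a trajectory of `f` in `S`, regardless of the direction of the flow. -/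
def IsHyperbolicSector {E : Type*} [NormedAddCommGroup E] [NormedSpace ℝ E]
    (f : E → E) (x₀ : E) (S A B : Set E) : Prop :=
  ∃ φ : ℝ × ℝ → E, IsSectorChart φ x₀ S A B ∧
    ∀ p ∈ modelSector,
      φ '' trajectoryIn modelSaddle modelSector p = trajectoryIn f S (φ p)

/-- A Delta: some neighbourhood of `x₀` is divided into exactly three sectors, all of them
hyperbolic. -/
def IsDelta {E : Type*} [NormedAddCommGroup E] [NormedSpace ℝ E] (f : E → E) (x₀ : E) : Prop :=
  ∃ D : SectorDecomposition x₀ 3,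
    ∀ i, IsHyperbolicSector f x₀ (D.sector i) (D.side i) (D.side (i + 1))

/-! A side of a hyperbolic sector, without the vertex, is a single trajectory, so the flow on it
runs either away from `x₀` or towards `x₀`. The nearby hyperbola-like trajectories follow one side
towards the vertex and the other away from it. By continuity of `f` they run alongside both sides in
the sense of the flow there, so one side is outgoing and the other incoming. Outgoing and incoming
sides therefore alternate around `x₀`, and closing the cycle after `n` steps forces `n` to be even.

The difficulty is that the equivalence only matches trajectories as sets, so directions have to be
recovered from `f`. A solution on an arc without equilibria cannot turn back
(`IsIntegralCurveOn.injOn_lift`), hence an arc that is one trajectory has a direction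
(`IsTrajectoryArc.flowsUp_or_flowsDown`). Near a regular point this direction passes to neighbouring
arcs (`exists_window_not_joins`). Comparing the two sides with one hyperbola gives
`IsSectorChart.flowsUp_and_flowsDown_or`. Finally, the direction of a side does not depend on which
adjacent sector parametrizes it (`IsOutgoing.not_isIncoming`). -/

/-! ### Directions of solutions along arcs -/

section SolutionArcs

/-- A continuous path in the image of an injective continuous map on a compact set lifts. -/
theorem exists_continuousOn_lift {X : Type*} [TopologicalSpace X] [T2Space X] {β : ℝ → X}
    {K : Set ℝ} (hK : IsCompact K) (hβ : ContinuousOn β K) (hi : InjOn β K) {γ : ℝ → X}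
    {D : Set ℝ} (hγ : ContinuousOn γ D)
    (hm : ∀ τ ∈ D, γ τ ∈ β '' K) :
    ∃ h : ℝ → ℝ, ContinuousOn h D ∧ ∀ τ ∈ D, h τ ∈ K ∧ β (h τ) = γ τ := by
  choose! h hhK hh using hm
  refine ⟨h, ?_, fun τ hτ => ⟨hhK τ hτ, hh τ hτ⟩⟩
  have : CompactSpace K := isCompact_iff_compactSpace.1 hK
  -- A continuous injection of a compact space into a Hausdorff space is an embedding, so continuity
  -- of the lift can be tested after composing with `β`.
  have hemb : IsClosedEmbedding (K.domRestrict β) :=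
    (continuousOn_iff_continuous_domRestrict.1 hβ).isClosedEmbedding (injOn_iff_injective.1 hi)
  rw [continuousOn_iff_continuous_domRestrict] at hγ ⊢
  let k : D → K := fun τ => ⟨h τ, hhK τ τ.2⟩
  have hk : Continuous k := by
    rw [hemb.isInducing.continuous_iff]
    convert hγ using 1
    ext τ : 1
    exact hh τ τ.2
  exact continuous_subtype_val.comp hk

variable {E : Type*} [NormedAddCommGroup E] [InnerProductSpace ℝ E]

/-- A solution of `ẋ = f x` leads, forwards in time, from `β s` to `β t` along the arc `β`. -/
def Joins (f : E → E) (β : ℝ → E) (s t : ℝ) : Prop :=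
  ∃ (γ : ℝ → E) (a b : ℝ), a ≤ b ∧ IsIntegralCurveOn γ (fun _ => f) (Icc a b) ∧
    γ a = β s ∧ γ b = β t ∧ ∀ τ ∈ Icc a b, γ τ ∈ β '' uIcc s t

/-- The flow of `f` runs along `β` over `J` in the direction of increasing parameter. -/
def FlowsUp (f : E → E) (β : ℝ → E) (J : Set ℝ) : Prop :=
  ∀ s ∈ J, ∀ t ∈ J, s < t → Joins f β s t

/-- The flow of `f` runs along `β` over `J` in the direction of decreasing parameter. -/
def FlowsDown (f : E → E) (β : ℝ → E) (J : Set ℝ) : Prop :=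
  ∀ s ∈ J, ∀ t ∈ J, s < t → Joins f β t s

theorem Joins.reparam {f : E → E} {β β' : ℝ → E} {g : ℝ → ℝ} {s t : ℝ} (h : Joins f β s t)
    (hβ : ∀ w ∈ uIcc s t, β w = β' (g w)) (hg : MapsTo g (uIcc s t) (uIcc (g s) (g t))) :
    Joins f β' (g s) (g t) := by
  obtain ⟨γ, a, b, hab, hγ, ha, hb, hm⟩ := h
  refine ⟨γ, a, b, hab, hγ, by rw [ha, hβ s left_mem_uIcc], by rw [hb, hβ t right_mem_uIcc], ?_⟩
  intro τ hτ
  obtain ⟨w, hw, hwτ⟩ := hm τ hτ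
  exact ⟨g w, hg hw, by rw [← hβ w hw, hwτ]⟩

/-- Uniqueness for the initial value problem: `f` is Lipschitz on the compact image of the solution,
so the solution agrees with the constant one. This is where `C¹`, rather than continuity, matters.
-/
theorem trajectoryIn_subset_of_eq_zero {f : E → E} (hf : ContDiff ℝ 1 f) {S : Set E} {p : E}
    (hp : f p = 0) : trajectoryIn f S p ⊆ {p} := by
  rintro q ⟨γ, a, b, hγ, ha, hb, -⟩
  have hc := hγ.continuousOn
  obtain ⟨K, hK⟩ := (hf.locallyLipschitz.locallyLipschitzOn
    (s := γ '' uIcc a b)).exists_lipschitzOnWith_of_compact (isCompact_uIcc.image_of_continuousOn hc)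
  have hmem : ∀ t ∈ uIcc a b, γ t ∈ γ '' uIcc a b := fun t ht => mem_image_of_mem γ ht
  have hp' : p ∈ γ '' uIcc a b := ⟨a, left_mem_uIcc, ha⟩
  have hconst : ∀ t s, HasDerivWithinAt (fun _ : ℝ => p) (f p) s t := fun t s => by
    rw [hp]; exact hasDerivWithinAt_const ..
  rcases le_total a b with hab | hab
  · rw [uIcc_of_le hab] at *
    have := ODE_solution_unique_of_mem_Icc_right (v := fun _ => f)
      (s := fun _ => γ '' Icc a b) (f := γ) (g := fun _ => p) (fun _ _ => hK) hc
      (fun t ht => (hγ t (Ico_subset_Icc_self ht)).mono_of_mem_nhdsWithin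
        (Icc_mem_nhdsGE_of_mem ht))
      (fun t ht => hmem t (Ico_subset_Icc_self ht)) continuousOn_const
      (fun t _ => hconst t _) (fun _ _ => hp') ha
    rw [mem_singleton_iff, ← hb, this (right_mem_Icc.2 hab)]
  · rw [uIcc_of_ge hab] at *
    have := ODE_solution_unique_of_mem_Icc_left (v := fun _ => f)
      (s := fun _ => γ '' Icc b a) (f := γ) (g := fun _ => p) (fun _ _ => hK) hc
      (fun t ht => (hγ t (Ioc_subset_Icc_self ht)).mono_of_mem_nhdsWithin
        (Icc_mem_nhdsLE_of_mem ht))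
      (fun t ht => hmem t (Ioc_subset_Icc_self ht)) continuousOn_const
      (fun t _ => hconst t _) (fun _ _ => hp') ha
    rw [mem_singleton_iff, ← hb, this (left_mem_Icc.2 hab)]

/-- The derivative of `⟨v, γ⟩` is `⟨v, f γ⟩`. With `v` the value of `f` at a regular point, this
functional is a local clock that detects the direction of the flow. -/
theorem IsIntegralCurveOn.strictMonoOn_inner {f : E → E} {γ : ℝ → E} {D : Set ℝ}
    (hD : Convex ℝ D) (hγ : IsIntegralCurveOn γ (fun _ => f) D) {v : E}
    (hv : ∀ τ ∈ D, 0 < inner ℝ v (f (γ τ))) :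
    StrictMonoOn (fun τ => inner ℝ v (γ τ)) D := by
  refine strictMonoOn_of_hasDerivWithinAt_pos (f' := fun τ => inner ℝ v (f (γ τ))) hD
    (continuousOn_const.inner hγ.continuousOn) (fun τ hτ => ?_)
    (fun τ hτ => hv τ (interior_subset hτ))
  have h := (hγ τ (interior_subset hτ)).mono interior_subset
  simpa using (hasDerivWithinAt_const τ (interior D) v).inner ℝ h

theorem Joins.inner_le {f : E → E} {β : ℝ → E} {s t : ℝ} (h : Joins f β s t) {v : E}
    (hv : ∀ w ∈ uIcc s t, 0 < inner ℝ v (f (β w))) :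
    inner ℝ v (β s) ≤ inner ℝ v (β t) := by
  obtain ⟨γ, a, b, hab, hγ, ha, hb, hm⟩ := h
  have := hγ.strictMonoOn_inner (convex_Icc a b) (v := v) fun τ hτ => by
    obtain ⟨w, hw, hwτ⟩ := hm τ hτ
    exact hwτ ▸ hv w hw
  have h2 := this.monotoneOn (left_mem_Icc.2 hab) (right_mem_Icc.2 hab) hab
  simpa [ha, hb] using h2

theorem Joins.inner_lt {f : E → E} {β : ℝ → E} {s t : ℝ} (h : Joins f β s t) (hst : β s ≠ β t)
    {v : E} (hv : ∀ w ∈ uIcc s t, 0 < inner ℝ v (f (β w))) :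
    inner ℝ v (β s) < inner ℝ v (β t) := by
  obtain ⟨γ, a, b, hab, hγ, ha, hb, hm⟩ := h
  have := hγ.strictMonoOn_inner (convex_Icc a b) (v := v) fun τ hτ => by
    obtain ⟨w, hw, hwτ⟩ := hm τ hτ
    exact hwτ ▸ hv w hw
  have hab' : a < b := hab.lt_of_ne fun h => hst (by rw [← ha, ← hb, h])
  have h2 := this (left_mem_Icc.2 hab) (right_mem_Icc.2 hab) hab'
  simpa [ha, hb] using h2

theorem IsIntegralCurveOn.exists_injOn_Icc {f : E → E} (hf : Continuous f)
    {γ : ℝ → E} {a b τ : ℝ} (hγ : IsIntegralCurveOn γ (fun _ => f) (Icc a b)) (hτ : τ ∈ Ioo a b)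
    (h0 : f (γ τ) ≠ 0) : ∃ ε > 0, Icc (τ - ε) (τ + ε) ⊆ Icc a b ∧
      InjOn γ (Icc (τ - ε) (τ + ε)) := by
  have hc : ContinuousAt (fun t => inner ℝ (f (γ τ)) (f (γ t))) τ :=
    continuousAt_const.inner (hf.continuousAt.comp
      (hγ.continuousOn.continuousAt (Icc_mem_nhds hτ.1 hτ.2)))
  have hpos : 0 < inner ℝ (f (γ τ)) (f (γ τ)) := real_inner_self_pos.2 h0
  have hev := (hc.eventually (lt_mem_nhds hpos)).and (Icc_mem_nhds hτ.1 hτ.2)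
  obtain ⟨ε, hε, hball⟩ := Metric.nhds_basis_closedBall.mem_iff.1 hev
  rw [Real.closedBall_eq_Icc] at hball
  refine ⟨ε, hε, fun t ht => (hball ht).2, ?_⟩
  have := (hγ.mono fun t ht => (hball ht).2 : IsIntegralCurveOn γ (fun _ => f)
    (Icc (τ - ε) (τ + ε))).strictMonoOn_inner (convex_Icc _ _) fun t ht => (hball ht).1
  intro x hx y hy hxy
  exact this.injOn hx hy (by simp [hxy])

/-- A solution without equilibria that runs along an arc cannot turn back. -/
theorem IsIntegralCurveOn.injOn_lift {f : E → E} (hf : Continuous f) {γ β : ℝ → E} {a b : ℝ}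
    (hγ : IsIntegralCurveOn γ (fun _ => f) (Icc a b)) (h0 : ∀ τ ∈ Icc a b, f (γ τ) ≠ 0)
    {h : ℝ → ℝ} (hc : ContinuousOn h (Icc a b)) (hh : ∀ τ ∈ Icc a b, β (h τ) = γ τ) :
    InjOn h (Icc a b) := by
  -- As in Rolle's theorem, equal values would give an interior local extremum `c` of `h`. But near
  -- `c` the solution, and with it `h`, is injective, so `h` is strictly monotone there.
  have key : ∀ x ∈ Icc a b, ∀ y ∈ Icc a b, x < y → h x ≠ h y := by
    intro x hx y hy hxy heq
    have hsub : Icc x y ⊆ Icc a b := Icc_subset_Icc hx.1 hy.2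
    obtain ⟨c, hcm, hext⟩ := exists_isLocalExtr_Ioo hxy (hc.mono hsub) heq
    have hc' : c ∈ Ioo a b := ⟨hx.1.trans_lt hcm.1, hcm.2.trans_le hy.2⟩
    obtain ⟨ε, hε, hs, hinj⟩ := hγ.exists_injOn_Icc hf hc' (h0 c (Ioo_subset_Icc_self hc'))
    have hinj' : InjOn h (Icc (c - ε) (c + ε)) := fun x hx y hy hxy =>
      hinj hx hy (by rw [← hh x (hs hx), ← hh y (hs hy), hxy])
    have hne : ∃ p q, p ∈ Icc (c - ε) (c + ε) ∧ q ∈ Icc (c - ε) (c + ε) ∧ p < c ∧ c < q ∧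
        ((h c ≤ h p ∧ h c ≤ h q) ∨ (h p ≤ h c ∧ h q ≤ h c)) := by
      rcases hext with hmin | hmax
      · obtain ⟨δ, hδ, hb⟩ := Metric.nhds_basis_closedBall.mem_iff.1 hmin
        rw [Real.closedBall_eq_Icc] at hb
        have h1 := min_le_left ε δ
        have h2 := min_le_right ε δ
        have h3 := lt_min hε hδ
        refine ⟨c - min ε δ, c + min ε δ, ⟨by linarith, by linarith⟩, ⟨by linarith, by linarith⟩,
          by linarith, by linarith, Or.inl ⟨hb ⟨by linarith, by linarith⟩,
          hb ⟨by linarith, by linarith⟩⟩⟩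
      · obtain ⟨δ, hδ, hb⟩ := Metric.nhds_basis_closedBall.mem_iff.1 hmax
        rw [Real.closedBall_eq_Icc] at hb
        have h1 := min_le_left ε δ
        have h2 := min_le_right ε δ
        have h3 := lt_min hε hδ
        refine ⟨c - min ε δ, c + min ε δ, ⟨by linarith, by linarith⟩, ⟨by linarith, by linarith⟩,
          by linarith, by linarith, Or.inr ⟨hb ⟨by linarith, by linarith⟩,
          hb ⟨by linarith, by linarith⟩⟩⟩
    obtain ⟨p, q, hp, hq, hpc, hcq, hor⟩ := hne
    have hcc : c ∈ Icc (c - ε) (c + ε) := ⟨by linarith, by linarith⟩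
    rcases (hc.mono hs).strictMonoOn_of_injOn_Icc' (by linarith) hinj' with hm | hm
    · have := hm hp hcc hpc
      have := hm hcc hq hcq
      rcases hor with ⟨_, _⟩ | ⟨_, _⟩ <;> linarith
    · have := hm hp hcc hpc
      have := hm hcc hq hcq
      rcases hor with ⟨_, _⟩ | ⟨_, _⟩ <;> linarith
  intro x hx y hy hxy
  rcases lt_trichotomy x y with h | h | h
  · exact absurd hxy (key x hx y hy h)
  · exact h
  · exact absurd hxy.symm (key y hy x hx h)

/-- A solution that connects two points of an arc inside the arc connects all the points
in between, in the same order. -/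
theorem IsIntegralCurveOn.joins {f : E → E} (hf : Continuous f) {β γ : ℝ → E} {K : Set ℝ}
    (hK : IsCompact K) (hβ : ContinuousOn β K) (hi : InjOn β K) {a b s₀ t₀ : ℝ} (hab : a ≤ b)
    (hγ : IsIntegralCurveOn γ (fun _ => f) (Icc a b)) (h0 : ∀ τ ∈ Icc a b, f (γ τ) ≠ 0)
    (hm : ∀ τ ∈ Icc a b, γ τ ∈ β '' K) (hs₀ : s₀ ∈ K) (ht₀ : t₀ ∈ K)
    (ha : γ a = β s₀) (hb : γ b = β t₀) {s t : ℝ}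
    (hst : (s₀ ≤ s ∧ s ≤ t ∧ t ≤ t₀) ∨ (t₀ ≤ t ∧ t ≤ s ∧ s ≤ s₀)) : Joins f β s t := by
  obtain ⟨h, hc, hh⟩ := exists_continuousOn_lift hK hβ hi hγ.continuousOn hm
  have hinj := hγ.injOn_lift hf h0 hc fun τ hτ => (hh τ hτ).2
  have haI := left_mem_Icc.2 hab
  have hbI := right_mem_Icc.2 hab
  have ha' : h a = s₀ := hi (hh a haI).1 hs₀ (by rw [(hh a haI).2, ha])
  have hb' : h b = t₀ := hi (hh b hbI).1 ht₀ (by rw [(hh b hbI).2, hb])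
  have hsub : uIcc s₀ t₀ ⊆ h '' Icc a b := by
    have := intermediate_value_uIcc (f := h) (a := a) (b := b) (by rwa [uIcc_of_le hab])
    rwa [ha', hb', uIcc_of_le hab] at this
  obtain ⟨x, hx, hxs⟩ := hsub (show s ∈ uIcc s₀ t₀ by rw [mem_uIcc]; grind)
  obtain ⟨y, hy, hyt⟩ := hsub (show t ∈ uIcc s₀ t₀ by rw [mem_uIcc]; grind)
  have main : ∀ x y, x ∈ Icc a b → y ∈ Icc a b → h x = s → h y = t → x ≤ y →
      MapsTo h (Icc x y) (uIcc s t) → Joins f β s t := by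
    intro x y hx hy hxs hyt hxy hmaps
    have hs : Icc x y ⊆ Icc a b := Icc_subset_Icc hx.1 hy.2
    exact ⟨γ, x, y, hxy, hγ.mono hs, by rw [← (hh x hx).2, hxs], by rw [← (hh y hy).2, hyt],
      fun τ hτ => ⟨h τ, hmaps hτ, (hh τ (hs hτ)).2⟩⟩
  rcases eq_or_ne s t with rfl | hne
  · refine main x x hx hx hxs hxs le_rfl fun z hz => ?_
    rw [Icc_self, mem_singleton_iff] at hz
    simp [hz, hxs]
  -- `h` is strictly monotone, and its sense is that from `s₀` to `t₀`, which agrees with that from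
  -- `s` to `t`.
  have hxy : x ≤ y := by
    by_contra! hlt
    rcases hc.strictMonoOn_of_injOn_Icc' hab hinj with hm | hm
    · have h1 := hm hy hx hlt
      have h2 := hm.monotoneOn haI hbI hab
      grind
    · have h1 := hm hy hx hlt
      have h2 := hm.antitoneOn haI hbI hab
      grind
  refine main x y hx hy hxs hyt hxy fun z hz => ?_
  have hz' : z ∈ Icc a b := ⟨hx.1.trans hz.1, hz.2.trans hy.2⟩
  rw [mem_uIcc, ← hxs, ← hyt]
  rcases hc.strictMonoOn_of_injOn_Icc' hab hinj with hm | hm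
  · exact Or.inl ⟨hm.monotoneOn hx hz' hz.1, hm.monotoneOn hz' hy hz.2⟩
  · exact Or.inr ⟨hm.antitoneOn hz' hy hz.2, hm.antitoneOn hx hz' hz.1⟩

/-- Both journeys would cover a short initial piece of the arc, in opposite senses. There `⟨f (β s),
·⟩` increases along every solution, so its end values would be ordered in both ways. -/
theorem Joins.not_symm {f : E → E} (hf : Continuous f) {β : ℝ → E} {s t : ℝ} (hst : s < t)
    (hβ : ContinuousOn β (Icc s t)) (hi : InjOn β (Icc s t)) (h0 : ∀ w ∈ Icc s t, f (β w) ≠ 0)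
    (h : Joins f β s t) : ¬ Joins f β t s := by
  intro h'
  have hs : s ∈ Icc s t := left_mem_Icc.2 hst.le
  have ht : t ∈ Icc s t := right_mem_Icc.2 hst.le
  have hc : ContinuousWithinAt (fun w => inner ℝ (f (β s)) (f (β w))) (Icc s t) s :=
    continuousWithinAt_const.inner (hf.continuousAt.comp_continuousWithinAt (hβ s hs))
  have hev := hc.eventually (lt_mem_nhds (real_inner_self_pos.2 (h0 s hs)))
  obtain ⟨ε, hε, hball⟩ := Metric.mem_nhdsWithin_iff.1 hev
  set u := min t (s + ε / 2) with hu
  have hsu : s < u := lt_min hst (by linarith)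
  have hut : u ≤ t := min_le_left _ _
  have hpos : ∀ w ∈ uIcc s u, 0 < inner ℝ (f (β s)) (f (β w)) := by
    intro w hw
    rw [uIcc_of_le hsu.le] at hw
    refine hball ⟨?_, hw.1, hw.2.trans hut⟩
    rw [Metric.mem_ball, Real.dist_eq, abs_of_nonneg (by linarith [hw.1])]
    linarith [hw.2, min_le_right t (s + ε / 2)]
  have hne : β s ≠ β u := fun h => hsu.ne (hi hs ⟨hsu.le, hut⟩ h)
  obtain ⟨γ, a, b, hab, hγ, ha, hb, hm⟩ := h
  obtain ⟨γ', a', b', hab', hγ', ha', hb', hm'⟩ := h'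
  rw [uIcc_of_le hst.le] at hm
  rw [uIcc_of_ge hst.le] at hm'
  have h1 : Joins f β s u := hγ.joins hf isCompact_Icc hβ hi hab
    (fun τ hτ => by obtain ⟨w, hw, e⟩ := hm τ hτ; exact e ▸ h0 w hw) hm hs ht ha hb
    (Or.inl ⟨le_rfl, hsu.le, hut⟩)
  have h2 : Joins f β u s := hγ'.joins hf isCompact_Icc hβ hi hab'
    (fun τ hτ => by obtain ⟨w, hw, e⟩ := hm' τ hτ; exact e ▸ h0 w hw) hm' ht hs ha' hb'
    (Or.inr ⟨le_rfl, hsu.le, hut⟩)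
  exact absurd (h2.inner_le (by rwa [uIcc_comm])) (not_le.2 (h1.inner_lt hne hpos))

/-- The arc `β` over `J` is a trajectory of `f` in `S`. -/
structure IsTrajectoryArc (f : E → E) (S : Set E) (β : ℝ → E) (J K : Set ℝ) : Prop where
  isCompact : IsCompact K
  subset : J ⊆ K
  nontrivial : J.Nontrivial
  continuousOn : ContinuousOn β K
  injOn : InjOn β K
  trajectoryIn_eq : ∀ s ∈ J, trajectoryIn f S (β s) = β '' J

theorem IsTrajectoryArc.ne_zero {f : E → E} (hf : ContDiff ℝ 1 f) {S : Set E} {β : ℝ → E}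
    {J K : Set ℝ} (h : IsTrajectoryArc f S β J K) {s : ℝ} (hs : s ∈ J) : f (β s) ≠ 0 := by
  intro h0
  obtain ⟨t, ht, hne⟩ := h.nontrivial.exists_ne s
  have : β t ∈ trajectoryIn f S (β s) := h.trajectoryIn_eq s hs ▸ mem_image_of_mem β ht
  exact hne (h.injOn (h.subset ht) (h.subset hs) (trajectoryIn_subset_of_eq_zero hf h0 this))

/-- A solution in `S` from `β m` to `β M` stays in its trajectory, that is, on the arc, and sweeps
all points in between in order. Lifting it requires the compact `K`, since `J` is half-open for the
sides of a sector. -/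
theorem IsTrajectoryArc.joins_or {f : E → E} (hf : ContDiff ℝ 1 f) {S : Set E} {β : ℝ → E}
    {J K : Set ℝ} (h : IsTrajectoryArc f S β J K) {m M : ℝ} (hm : m ∈ J) (hM : M ∈ J) :
    (∀ s t, m ≤ s → s ≤ t → t ≤ M → Joins f β s t) ∨
      (∀ s t, m ≤ s → s ≤ t → t ≤ M → Joins f β t s) := by
  have hcurve : ∀ (γ : ℝ → E) (a b s₀ t₀ : ℝ), a ≤ b → s₀ ∈ J → t₀ ∈ J →
      IsIntegralCurveOn γ (fun _ => f) (Icc a b) → (∀ τ ∈ Icc a b, γ τ ∈ β '' J) →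
      γ a = β s₀ → γ b = β t₀ → ∀ s t, (s₀ ≤ s ∧ s ≤ t ∧ t ≤ t₀) ∨ (t₀ ≤ t ∧ t ≤ s ∧ s ≤ s₀) →
      Joins f β s t := by
    intro γ a b s₀ t₀ hab hs₀ ht₀ hγ hmem ha hb s t hst
    refine hγ.joins hf.continuous h.isCompact h.continuousOn h.injOn hab (fun τ hτ => ?_)
      (fun τ hτ => image_mono h.subset (hmem τ hτ)) (h.subset hs₀) (h.subset ht₀) ha hb hst
    obtain ⟨w, hw, e⟩ := hmem τ hτ
    exact e ▸ h.ne_zero hf hw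
  have hmM : β M ∈ trajectoryIn f S (β m) := h.trajectoryIn_eq m hm ▸ mem_image_of_mem β hM
  obtain ⟨γ, a, b, hγ, ha, hb, hS⟩ := hmM
  have hmem : ∀ τ ∈ uIcc a b, γ τ ∈ β '' J := by
    intro τ hτ
    rw [← h.trajectoryIn_eq m hm]
    have hsub : uIcc a τ ⊆ uIcc a b := uIcc_subset_uIcc_left hτ
    exact ⟨γ, a, τ, hγ.mono hsub, ha, rfl, fun x hx => hS x (hsub hx)⟩
  rcases le_total a b with hab | hab
  · rw [uIcc_of_le hab] at hγ hmem
    exact Or.inl fun s t h1 h2 h3 => hcurve γ a b m M hab hm hM hγ hmem ha hb s t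
      (Or.inl ⟨h1, h2, h3⟩)
  · rw [uIcc_of_ge hab] at hγ hmem
    exact Or.inr fun s t h1 h2 h3 => hcurve γ b a M m hab hM hm hγ hmem hb ha t s
      (Or.inr ⟨h1, h2, h3⟩)

/-- `IsTrajectoryArc.joins_or` fixes a direction on one window at a time. A pair violating one
direction and a pair violating the other fit into a common window. -/
theorem IsTrajectoryArc.flowsUp_or_flowsDown {f : E → E} (hf : ContDiff ℝ 1 f) {S : Set E}
    {β : ℝ → E} {J K : Set ℝ} (h : IsTrajectoryArc f S β J K) :
    FlowsUp f β J ∨ FlowsDown f β J := by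
  by_contra! hcon
  obtain ⟨h1, h2⟩ := hcon
  simp only [FlowsUp, FlowsDown, not_forall] at h1 h2
  obtain ⟨s₁, hs₁, t₁, ht₁, hlt₁, hn₁⟩ := h1
  obtain ⟨s₂, hs₂, t₂, ht₂, hlt₂, hn₂⟩ := h2
  have hm : min s₁ s₂ ∈ J := by rcases min_choice s₁ s₂ with e | e <;> rw [e] <;> assumption
  have hM : max t₁ t₂ ∈ J := by rcases max_choice t₁ t₂ with e | e <;> rw [e] <;> assumption
  rcases h.joins_or hf hm hM with h | h
  · exact hn₁ (h _ _ (min_le_left _ _) hlt₁.le (le_max_left _ _))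
  · exact hn₂ (h _ _ (min_le_right _ _) hlt₂.le (le_max_right _ _))

/-- Near a regular point of the arc `Φ (0, ·)`, the neighbouring arcs `Φ (c, ·)` cannot be
traversed in the opposite direction. -/
theorem exists_window_not_joins {f : E → E} (hf : Continuous f) {Φ : ℝ × ℝ → E} {w₀ r : ℝ}
    (hr : 0 < r) (hΦ : ContinuousOn Φ (Icc 0 r ×ˢ Icc (w₀ - r) (w₀ + r)))
    (hi : InjOn (fun w => Φ (0, w)) (Icc (w₀ - r) (w₀ + r))) (h0 : f (Φ (0, w₀)) ≠ 0) :
    ∃ t, w₀ < t ∧ t ≤ w₀ + r ∧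
      (Joins f (fun w => Φ (0, w)) w₀ t →
        ∀ᶠ c in 𝓝[>] (0 : ℝ), ¬ Joins f (fun w => Φ (c, w)) t w₀) ∧
      (Joins f (fun w => Φ (0, w)) t w₀ →
        ∀ᶠ c in 𝓝[>] (0 : ℝ), ¬ Joins f (fun w => Φ (c, w)) w₀ t) := by
  set R := Icc (0 : ℝ) r ×ˢ Icc (w₀ - r) (w₀ + r) with hR
  set v := f (Φ (0, w₀)) with hv
  have hmemR : ((0 : ℝ), w₀) ∈ R := ⟨⟨le_rfl, hr.le⟩, by constructor <;> simp [hr.le]⟩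
  have hc : ContinuousWithinAt (fun q => inner ℝ v (f (Φ q))) R (0, w₀) :=
    continuousWithinAt_const.inner (hf.continuousAt.comp_continuousWithinAt (hΦ _ hmemR))
  have hev := hc.eventually (lt_mem_nhds (real_inner_self_pos.2 h0))
  obtain ⟨ε, hε, hball⟩ := Metric.mem_nhdsWithin_iff.1 hev
  set δ := min r (ε / 2) with hδ
  have hδ0 : 0 < δ := lt_min hr (by linarith)
  have hδr : δ ≤ r := min_le_left _ _
  have hδε : δ < ε := (min_le_right _ _).trans_lt (by linarith)
  -- By continuity, the one functional `⟨v, ·⟩` is a clock for all the neighbouring arcs at once.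
  have hpos : ∀ c ∈ Icc 0 δ, ∀ w ∈ uIcc w₀ (w₀ + δ), 0 < inner ℝ v (f (Φ (c, w))) := by
    intro c hc w hw
    rw [uIcc_of_le (by linarith)] at hw
    refine hball ⟨?_, ⟨hc.1, hc.2.trans hδr⟩, by linarith [hw.1], by linarith [hw.2]⟩
    rw [Metric.mem_ball, Prod.dist_eq, max_lt_iff, Real.dist_eq, Real.dist_eq,
      abs_of_nonneg (by linarith [hc.1]), abs_of_nonneg (by linarith [hw.1])]
    constructor
    · linarith [hc.2]
    · linarith [hw.2]
  have hne : Φ (0, w₀) ≠ Φ (0, w₀ + δ) := fun h => by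
    have := hi (show w₀ ∈ Icc _ _ from ⟨by linarith, by linarith⟩)
      (show w₀ + δ ∈ Icc _ _ from ⟨by linarith, by linarith⟩) h
    linarith
  -- The clock readings at both ends depend continuously on `c`, so their strict order at `c = 0`
  -- persists and excludes the opposite traversal.
  have hlim : ∀ w ∈ Icc w₀ (w₀ + δ), Filter.Tendsto (fun c : ℝ => inner ℝ v (Φ (c, w)))
      (𝓝[>] 0) (𝓝 (inner ℝ v (Φ (0, w)))) := by
    intro w hw
    have h1 : ContinuousWithinAt (fun q => inner ℝ v (Φ q)) R (0, w) :=
      continuousWithinAt_const.inner (hΦ _ ⟨⟨le_rfl, hr.le⟩, by linarith [hw.1], by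
        linarith [hw.2]⟩)
    refine h1.tendsto.comp (tendsto_nhdsWithin_iff.2 ⟨?_, ?_⟩)
    · exact ((Continuous.prodMk_left w).tendsto 0).mono_left nhdsWithin_le_nhds
    · filter_upwards [Ioo_mem_nhdsGT hr] with c hc
      exact ⟨⟨hc.1.le, hc.2.le⟩, by linarith [hw.1], by linarith [hw.2]⟩
  have hl1 := hlim w₀ ⟨le_rfl, by linarith⟩
  have hl2 := hlim (w₀ + δ) ⟨by linarith, le_rfl⟩
  have h0δ : (0 : ℝ) ∈ Icc 0 δ := ⟨le_rfl, hδ0.le⟩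
  refine ⟨w₀ + δ, by linarith, by linarith, fun hj => ?_, fun hj => ?_⟩
  · have hlt := hj.inner_lt hne (hpos 0 h0δ)
    filter_upwards [hl1.eventually_lt hl2 hlt, Ioo_mem_nhdsGT hδ0] with c hc hcδ hjc
    have := hjc.inner_le (v := v) (by rw [uIcc_comm]; exact hpos c ⟨hcδ.1.le, hcδ.2.le⟩)
    exact absurd this (not_le.2 hc)
  · have hlt := hj.inner_lt hne.symm (v := v) (by rw [uIcc_comm]; exact hpos 0 h0δ)
    filter_upwards [hl2.eventually_lt hl1 hlt, Ioo_mem_nhdsGT hδ0] with c hc hcδ hjc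
    have := hjc.inner_le (hpos c ⟨hcδ.1.le, hcδ.2.le⟩)
    exact absurd this (not_le.2 hc)

end SolutionArcs

/-! ### Trajectories of the linear saddle in the unit square -/

section ModelSaddle

/-- Integrating factors: `e⁻ᵗ u` and `eᵗ v` have zero derivative along a solution. -/
theorem IsIntegralCurveOn.modelSaddle_eq {γ : ℝ → ℝ × ℝ} {a b : ℝ}
    (hγ : IsIntegralCurveOn γ (fun _ => modelSaddle) (uIcc a b)) :
    γ b = (Real.exp (b - a) * (γ a).1, Real.exp (-(b - a)) * (γ a).2) := by
  have hd : ∀ t ∈ uIcc a b, HasDerivWithinAt (fun t => (γ t).1) (γ t).1 (uIcc a b) t ∧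
      HasDerivWithinAt (fun t => (γ t).2) (-(γ t).2) (uIcc a b) t := by
    intro t ht
    have h : HasDerivWithinAt γ ((γ t).1, -(γ t).2) (uIcc a b) t := hγ t ht
    have h1 := (hasFDerivAt_fst (𝕜 := ℝ) (p := γ t)).comp_hasDerivWithinAt t h
    have h2 := (hasFDerivAt_snd (𝕜 := ℝ) (p := γ t)).comp_hasDerivWithinAt t h
    exact ⟨h1, h2⟩
  have hconst : ∀ g : ℝ → ℝ, (∀ t ∈ uIcc a b, HasDerivWithinAt g 0 (uIcc a b) t) → g a = g b := by
    intro g hg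
    have := (convex_uIcc a b).norm_image_sub_le_of_norm_hasDerivWithin_le (C := 0) hg
      (by simp) left_mem_uIcc right_mem_uIcc
    rw [zero_mul, norm_le_zero_iff, sub_eq_zero] at this
    exact this.symm
  have he : ∀ k t : ℝ, HasDerivWithinAt (fun t => Real.exp (k * t)) (k * Real.exp (k * t))
      (uIcc a b) t := by
    intro k t
    have := ((hasDerivAt_id t).const_mul k).exp.hasDerivWithinAt (s := uIcc a b)
    simpa [mul_comm] using this
  have e1 := hconst (fun t => Real.exp (-1 * t) * (γ t).1) fun t ht => by
    exact ((he (-1) t).mul (hd t ht).1).congr_deriv (by ring)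
  have e2 := hconst (fun t => Real.exp (1 * t) * (γ t).2) fun t ht => by
    exact ((he 1 t).mul (hd t ht).2).congr_deriv (by ring)
  simp only [neg_mul, one_mul] at e1 e2
  have hb : ∀ x : ℝ, Real.exp x * Real.exp (-x) = 1 := fun x => by simp [← Real.exp_add]
  ext
  · calc (γ b).1 = (Real.exp b * Real.exp (-b)) * (γ b).1 := by rw [hb, one_mul]
      _ = Real.exp b * (Real.exp (-a) * (γ a).1) := by rw [e1]; ring
      _ = _ := by rw [← mul_assoc, ← Real.exp_add]; rfl
  · calc (γ b).2 = (Real.exp b * Real.exp (-b)) * (γ b).2 := by rw [hb, one_mul]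
      _ = Real.exp (-b) * (Real.exp a * (γ a).2) := by rw [e2]; ring
      _ = _ := by rw [← mul_assoc, ← Real.exp_add, neg_sub, add_comm, ← sub_eq_add_neg]

theorem mem_trajectoryIn_modelSaddle {p q : ℝ × ℝ} (hp : p ∈ modelSector) :
    q ∈ trajectoryIn modelSaddle modelSector p ↔
      q ∈ modelSector ∧ ∃ τ : ℝ, q = (Real.exp τ * p.1, Real.exp (-τ) * p.2) := by
  constructor
  · rintro ⟨γ, a, b, hγ, rfl, rfl, hS⟩
    exact ⟨hS b right_mem_uIcc, b - a, hγ.modelSaddle_eq⟩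
  · rintro ⟨hq, τ, rfl⟩
    refine ⟨fun t => (Real.exp t * p.1, Real.exp (-t) * p.2), 0, τ, fun t _ => ?_, by simp, rfl, ?_⟩
    · have h1 := (Real.hasDerivAt_exp t).mul_const p.1
      have h2 := (hasDerivAt_neg t).exp.mul_const p.2
      have := (h1.prodMk h2).hasDerivWithinAt (s := uIcc 0 τ)
      simpa [modelSaddle] using this
    · obtain ⟨⟨hp1, hp1'⟩, hp2, hp2'⟩ := hp
      obtain ⟨⟨-, hq1⟩, -, hq2⟩ := hq
      simp only at hq1 hq2
      -- Both coordinates are monotone in time, so each is bounded by its value at one of the two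
      -- ends, which lie in the square.
      intro t ht
      refine ⟨⟨by positivity, ?_⟩, by positivity, ?_⟩ <;> simp only
      · rcases mem_uIcc.1 ht with ⟨h0, h1⟩ | ⟨h0, h1⟩
        · exact (mul_le_mul_of_nonneg_right (Real.exp_le_exp.2 h1) hp1).trans hq1
        · exact (mul_le_of_le_one_left hp1 (Real.exp_le_one_iff.2 h1)).trans hp1'
      · rcases mem_uIcc.1 ht with ⟨h0, h1⟩ | ⟨h0, h1⟩
        · exact (mul_le_of_le_one_left hp2 (Real.exp_le_one_iff.2 (by linarith))).trans hp2'
        · exact (mul_le_mul_of_nonneg_right (Real.exp_le_exp.2 (by linarith)) hp2).trans hq2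

/-- The point of the closed quadrant with product `c` and difference `w` of its coordinates. -/
noncomputable def saddlePoint (q : ℝ × ℝ) : ℝ × ℝ :=
  ((√(q.2 ^ 2 + 4 * q.1) + q.2) / 2, (√(q.2 ^ 2 + 4 * q.1) - q.2) / 2)

theorem continuous_saddlePoint : Continuous saddlePoint := by
  unfold saddlePoint
  fun_prop

theorem saddlePoint_sub (q : ℝ × ℝ) : (saddlePoint q).1 - (saddlePoint q).2 = q.2 := by
  simp only [saddlePoint]; ring

theorem saddlePoint_mul {c : ℝ} (hc : 0 ≤ c) (w : ℝ) :
    (saddlePoint (c, w)).1 * (saddlePoint (c, w)).2 = c := by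
  have := Real.sq_sqrt (show 0 ≤ w ^ 2 + 4 * c by positivity)
  simp only [saddlePoint]; linear_combination this / 4

theorem saddlePoint_nonneg {c : ℝ} (hc : 0 ≤ c) (w : ℝ) :
    0 ≤ (saddlePoint (c, w)).1 ∧ 0 ≤ (saddlePoint (c, w)).2 := by
  have := Real.abs_le_sqrt (show w ^ 2 ≤ w ^ 2 + 4 * c by linarith)
  have := abs_le.1 this
  simp only [saddlePoint]
  constructor <;> linarith

theorem saddlePoint_pos {c : ℝ} (hc : 0 < c) (w : ℝ) :
    0 < (saddlePoint (c, w)).1 ∧ 0 < (saddlePoint (c, w)).2 := by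
  have h1 := saddlePoint_nonneg hc.le w
  have h2 := saddlePoint_mul hc.le w
  constructor
  · refine h1.1.lt_of_ne fun h => ?_
    rw [← h, zero_mul] at h2; exact hc.ne h2
  · refine h1.2.lt_of_ne fun h => ?_
    rw [← h, mul_zero] at h2; exact hc.ne h2

theorem saddlePoint_eq {u v : ℝ} (hu : 0 ≤ u) (hv : 0 ≤ v) : saddlePoint (u * v, u - v) = (u, v) := by
  have : (u - v) ^ 2 + 4 * (u * v) = (u + v) ^ 2 := by ring
  simp only [saddlePoint, this, Real.sqrt_sq (add_nonneg hu hv)]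
  ext <;> simp

/-- At `c = 0` the hyperbola degenerates into both sides joined at the vertex: `w ≥ 0` runs out
along the first side and `w ≤ 0` runs in along the second. One parameter thus compares a hyperbola
with both sides. -/
theorem saddlePoint_zero_of_nonneg {w : ℝ} (hw : 0 ≤ w) : saddlePoint (0, w) = (w, 0) := by
  simpa using saddlePoint_eq hw le_rfl

theorem saddlePoint_zero_of_nonpos {w : ℝ} (hw : w ≤ 0) : saddlePoint (0, w) = (0, -w) := by
  simpa using saddlePoint_eq le_rfl (neg_nonneg.2 hw)

/-- With `c = u v` and `w = u - v`, one has `1 - c - w = (1 - u) (1 + v)` and `1 - c + w = (1 + u)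
(1 - v)`. -/
theorem saddlePoint_mem_modelSector {c : ℝ} (hc : 0 ≤ c) {w : ℝ} :
    saddlePoint (c, w) ∈ modelSector ↔ w ∈ Icc (-(1 - c)) (1 - c) := by
  obtain ⟨h1, h2⟩ := saddlePoint_nonneg hc w
  have h3 := saddlePoint_mul hc w
  have h4 := saddlePoint_sub (c, w)
  generalize saddlePoint (c, w) = p at *
  obtain ⟨u, v⟩ := p
  simp only [modelSector, mem_prod, mem_Icc] at *
  subst h4 h3
  constructor
  · rintro ⟨⟨-, hu⟩, -, hv⟩
    constructor <;> nlinarith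
  · rintro ⟨ha, hb⟩
    refine ⟨⟨h1, ?_⟩, h2, ?_⟩
    · by_contra! h; nlinarith
    · by_contra! h; nlinarith

theorem trajectoryIn_modelSaddle_saddlePoint {c w : ℝ} (hc : 0 < c)
    (hw : w ∈ Icc (-(1 - c)) (1 - c)) :
    trajectoryIn modelSaddle modelSector (saddlePoint (c, w)) =
      (fun w => saddlePoint (c, w)) '' Icc (-(1 - c)) (1 - c) := by
  have hp := (saddlePoint_mem_modelSector hc.le).2 hw
  have hpos := saddlePoint_pos hc w
  have hmul := saddlePoint_mul hc.le w
  ext q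
  rw [mem_trajectoryIn_modelSaddle hp]
  constructor
  · rintro ⟨hq, τ, rfl⟩
    have he : saddlePoint (c, Real.exp τ * (saddlePoint (c, w)).1 -
        Real.exp (-τ) * (saddlePoint (c, w)).2) = (Real.exp τ * (saddlePoint (c, w)).1,
        Real.exp (-τ) * (saddlePoint (c, w)).2) := by
      rw [← saddlePoint_eq (mul_nonneg (Real.exp_pos _).le hpos.1.le)
        (mul_nonneg (Real.exp_pos _).le hpos.2.le)]
      congr 2
      have : Real.exp τ * Real.exp (-τ) = 1 := by simp [← Real.exp_add]
      linear_combination (-1 : ℝ) * hmul - c * this + (1 - Real.exp τ * Real.exp (-τ)) * (hmul)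
    refine ⟨_, (saddlePoint_mem_modelSector hc.le).1 ?_, he⟩
    rwa [he]
  · rintro ⟨w', hw', rfl⟩
    have hpos' := saddlePoint_pos hc w'
    have hmul' := saddlePoint_mul hc.le w'
    -- The travel time is read off from the first coordinate; the second then agrees because both
    -- products equal `c`.
    refine ⟨(saddlePoint_mem_modelSector hc.le).2 hw', Real.log ((saddlePoint (c, w')).1 /
      (saddlePoint (c, w)).1), ?_⟩
    have h1 := hpos.1.ne'
    have h2 := hpos'.1.ne'
    rw [Real.exp_neg, Real.exp_log (div_pos hpos'.1 hpos.1)]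
    ext
    · simp only; field_simp
    · simp only; field_simp; linarith

theorem trajectoryIn_modelSaddle_side₀ {w : ℝ} (hw : w ∈ Ioc (0 : ℝ) 1) :
    trajectoryIn modelSaddle modelSector (w, 0) = (fun w => (w, 0)) '' Ioc (0 : ℝ) 1 := by
  ext ⟨u, v⟩
  rw [mem_trajectoryIn_modelSaddle ⟨⟨hw.1.le, hw.2⟩, by simp⟩]
  constructor
  · rintro ⟨⟨⟨-, hu⟩, -⟩, τ, hτ⟩
    simp only [mul_zero, Prod.mk.injEq] at hτ hu
    exact ⟨u, ⟨hτ.1 ▸ mul_pos (Real.exp_pos _) hw.1, hu⟩, by rw [hτ.2]⟩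
  · rintro ⟨w', hw', h⟩
    simp only [Prod.mk.injEq] at h
    obtain ⟨rfl, rfl⟩ := h
    refine ⟨⟨⟨hw'.1.le, hw'.2⟩, by simp⟩, Real.log (w' / w), ?_⟩
    rw [Real.exp_log (div_pos hw'.1 hw.1), mul_zero, div_mul_cancel₀ _ hw.1.ne']

theorem trajectoryIn_modelSaddle_side₁ {w : ℝ} (hw : w ∈ Ioc (0 : ℝ) 1) :
    trajectoryIn modelSaddle modelSector (0, w) = (fun w => (0, w)) '' Ioc (0 : ℝ) 1 := by
  ext ⟨u, v⟩
  rw [mem_trajectoryIn_modelSaddle ⟨by simp, ⟨hw.1.le, hw.2⟩⟩]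
  constructor
  · rintro ⟨⟨-, -, hv⟩, τ, hτ⟩
    simp only [mul_zero, Prod.mk.injEq] at hτ hv
    exact ⟨v, ⟨hτ.2 ▸ mul_pos (Real.exp_pos _) hw.1, hv⟩, by rw [hτ.1]⟩
  · rintro ⟨w', hw', h⟩
    simp only [Prod.mk.injEq] at h
    obtain ⟨rfl, rfl⟩ := h
    refine ⟨⟨by simp, ⟨hw'.1.le, hw'.2⟩⟩, -Real.log (w' / w), ?_⟩
    rw [neg_neg, Real.exp_log (div_pos hw'.1 hw.1), mul_zero, div_mul_cancel₀ _ hw.1.ne']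

end ModelSaddle

/-! ### Directions on the two sides of a hyperbolic sector -/

section HyperbolicSector

theorem IsSectorChart.continuousOn_side₀ {X : Type*} [TopologicalSpace X] {φ : ℝ × ℝ → X} {x₀ : X}
    {S A B : Set X} (h : IsSectorChart φ x₀ S A B) :
    ContinuousOn (fun w => φ (w, 0)) (Icc 0 1) :=
  h.continuousOn.comp (by fun_prop) fun w hw => ⟨hw, by simp⟩

theorem IsSectorChart.continuousOn_side₁ {X : Type*} [TopologicalSpace X] {φ : ℝ × ℝ → X} {x₀ : X}
    {S A B : Set X} (h : IsSectorChart φ x₀ S A B) :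
    ContinuousOn (fun w => φ (0, w)) (Icc 0 1) :=
  h.continuousOn.comp (by fun_prop) fun w hw => ⟨by simp, hw⟩

theorem IsSectorChart.injOn_side₀ {X : Type*} [TopologicalSpace X] {φ : ℝ × ℝ → X} {x₀ : X}
    {S A B : Set X} (h : IsSectorChart φ x₀ S A B) :
    InjOn (fun w => φ (w, 0)) (Icc 0 1) := by
  have hm : ∀ w ∈ Icc (0 : ℝ) 1, (w, (0 : ℝ)) ∈ modelSector \ (modelSide₁ \ {(0, 0)}) := by
    intro w hw
    refine ⟨⟨hw, by simp⟩, fun h => h.2 ?_⟩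
    have : w = 0 := h.1.1
    simp [this]
  intro x hx y hy hxy
  exact congrArg Prod.fst (h.injOn₀ (hm x hx) (hm y hy) hxy)

theorem IsSectorChart.injOn_side₁ {X : Type*} [TopologicalSpace X] {φ : ℝ × ℝ → X} {x₀ : X}
    {S A B : Set X} (h : IsSectorChart φ x₀ S A B) :
    InjOn (fun w => φ (0, w)) (Icc 0 1) := by
  have hm : ∀ w ∈ Icc (0 : ℝ) 1, ((0 : ℝ), w) ∈ modelSector \ (modelSide₀ \ {(0, 0)}) := by
    intro w hw
    refine ⟨⟨by simp, hw⟩, fun h => h.2 ?_⟩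
    have : w = 0 := h.1.2
    simp [this]
  intro x hx y hy hxy
  exact congrArg Prod.snd (h.injOn₁ (hm x hx) (hm y hy) hxy)

variable {E : Type*} [NormedAddCommGroup E] [InnerProductSpace ℝ E] {f : E → E} {φ : ℝ × ℝ → E}
  {x₀ : E} {S A B : Set E}

theorem nontrivial_Ioc_zero_one : (Ioc (0 : ℝ) 1).Nontrivial :=
  ⟨1, by simp, 1 / 2, by constructor <;> norm_num, by norm_num⟩

theorem IsSectorChart.isTrajectoryArc_side₀ (h : IsSectorChart φ x₀ S A B)
    (hφ : ∀ p ∈ modelSector, φ '' trajectoryIn modelSaddle modelSector p = trajectoryIn f S (φ p)) :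
    IsTrajectoryArc f S (fun w => φ (w, 0)) (Ioc 0 1) (Icc 0 1) where
  isCompact := isCompact_Icc
  subset := Ioc_subset_Icc_self
  nontrivial := nontrivial_Ioc_zero_one
  continuousOn := h.continuousOn_side₀
  injOn := h.injOn_side₀
  trajectoryIn_eq w hw := by
    rw [← hφ (w, 0) ⟨Ioc_subset_Icc_self hw, by simp⟩, trajectoryIn_modelSaddle_side₀ hw, image_image]

theorem IsSectorChart.isTrajectoryArc_side₁ (h : IsSectorChart φ x₀ S A B)
    (hφ : ∀ p ∈ modelSector, φ '' trajectoryIn modelSaddle modelSector p = trajectoryIn f S (φ p)) :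
    IsTrajectoryArc f S (fun w => φ (0, w)) (Ioc 0 1) (Icc 0 1) where
  isCompact := isCompact_Icc
  subset := Ioc_subset_Icc_self
  nontrivial := nontrivial_Ioc_zero_one
  continuousOn := h.continuousOn_side₁
  injOn := h.injOn_side₁
  trajectoryIn_eq w hw := by
    rw [← hφ (0, w) ⟨by simp, Ioc_subset_Icc_self hw⟩, trajectoryIn_modelSaddle_side₁ hw, image_image]

/-- The bound `c < 1` excludes the corner `(1, 1)`, where the arc shrinks to a point. For `c > 0`
the hyperbola avoids the sides, so a possible identification of the sides does not affect
injectivity. -/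
theorem IsSectorChart.isTrajectoryArc_hyperbola (h : IsSectorChart φ x₀ S A B)
    (hφ : ∀ p ∈ modelSector, φ '' trajectoryIn modelSaddle modelSector p = trajectoryIn f S (φ p))
    {c : ℝ} (hc : 0 < c) (hc1 : c < 1) :
    IsTrajectoryArc f S (fun w => φ (saddlePoint (c, w))) (Icc (-(1 - c)) (1 - c))
      (Icc (-(1 - c)) (1 - c)) where
  isCompact := isCompact_Icc
  subset := Subset.rfl
  nontrivial := ⟨-(1 - c), ⟨le_rfl, by linarith⟩, 1 - c, ⟨by linarith, le_rfl⟩, by linarith⟩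
  continuousOn := h.continuousOn.comp (t := modelSector)
    (continuous_saddlePoint.comp (Continuous.prodMk_right c)).continuousOn
    fun w hw => (saddlePoint_mem_modelSector hc.le).2 hw
  injOn := by
    have hm : ∀ w ∈ Icc (-(1 - c)) (1 - c),
        saddlePoint (c, w) ∈ modelSector \ (modelSide₁ \ {(0, 0)}) := fun w hw =>
      ⟨(saddlePoint_mem_modelSector hc.le).2 hw, fun h' => (saddlePoint_pos hc w).1.ne' h'.1.1⟩
    intro x hx y hy hxy
    have := h.injOn₀ (hm x hx) (hm y hy) hxy
    simpa only [saddlePoint_sub] using congrArg (fun p : ℝ × ℝ => p.1 - p.2) this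
  trajectoryIn_eq w hw := by
    rw [← hφ _ ((saddlePoint_mem_modelSector hc.le).2 hw),
      trajectoryIn_modelSaddle_saddlePoint hc hw, image_image]

/-- In a hyperbolic sector the flow leaves the vertex along one side and
approaches it along the other one. -/
theorem IsSectorChart.flowsUp_and_flowsDown_or (hf : ContDiff ℝ 1 f)
    (h : IsSectorChart φ x₀ S A B)
    (hφ : ∀ p ∈ modelSector, φ '' trajectoryIn modelSaddle modelSector p = trajectoryIn f S (φ p)) :
    (FlowsUp f (fun w => φ (w, 0)) (Ioc 0 1) ∧ FlowsDown f (fun w => φ (0, w)) (Ioc 0 1)) ∨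
      (FlowsDown f (fun w => φ (w, 0)) (Ioc 0 1) ∧ FlowsUp f (fun w => φ (0, w)) (Ioc 0 1)) := by
  have h₀ := h.isTrajectoryArc_side₀ hφ
  have h₁ := h.isTrajectoryArc_side₁ hφ
  set Φ : ℝ × ℝ → E := fun q => φ (saddlePoint q) with hΦdef
  have hΦ : ∀ w₀ ∈ Icc (-(1 / 2) : ℝ) (1 / 2),
      ContinuousOn Φ (Icc 0 (1 / 4) ×ˢ Icc (w₀ - 1 / 4) (w₀ + 1 / 4)) := by
    intro w₀ hw₀
    refine h.continuousOn.comp continuous_saddlePoint.continuousOn fun q hq => ?_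
    exact (saddlePoint_mem_modelSector hq.1.1).2
      ⟨by linarith [hq.1.2, hq.2.1, hw₀.1], by linarith [hq.1.2, hq.2.2, hw₀.2]⟩
  have e₀ : ∀ w, 0 ≤ w → Φ (0, w) = φ (w, 0) := fun w hw => by
    simp only [hΦdef, saddlePoint_zero_of_nonneg hw]
  have e₁ : ∀ w, w ≤ 0 → Φ (0, w) = φ (0, -w) := fun w hw => by
    simp only [hΦdef, saddlePoint_zero_of_nonpos hw]
  -- One window is taken at the midpoint of each side, `w = 1 / 2` and `w = -(1 / 2)`. With radius
  -- `1 / 4` and `c ≤ 1 / 4`, both satisfy `|w| ≤ 3 / 4 ≤ 1 - c` and so stay in the sector.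
  obtain ⟨t₀, ht₀, ht₀', hup₀, hdown₀⟩ := exists_window_not_joins hf.continuous (w₀ := 1 / 2)
    (r := 1 / 4) (by norm_num) (hΦ _ (by norm_num))
    (fun x hx y hy hxy => by
      have hx0 : 0 ≤ x := by linarith [hx.1]
      have hy0 : 0 ≤ y := by linarith [hy.1]
      simp only [e₀ x hx0, e₀ y hy0] at hxy
      exact h.injOn_side₀ ⟨hx0, by linarith [hx.2]⟩ ⟨hy0, by linarith [hy.2]⟩ hxy)
    (by rw [e₀ _ (by norm_num)]; exact h₀.ne_zero hf (s := 1 / 2) (by norm_num))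
  obtain ⟨t₁, ht₁, ht₁', hup₁, hdown₁⟩ := exists_window_not_joins hf.continuous (w₀ := -(1 / 2))
    (r := 1 / 4) (by norm_num) (hΦ _ (by norm_num))
    (fun x hx y hy hxy => by
      have hx0 : x ≤ 0 := by linarith [hx.2]
      have hy0 : y ≤ 0 := by linarith [hy.2]
      simp only [e₁ x hx0, e₁ y hy0] at hxy
      exact neg_injective (h.injOn_side₁
        (show -x ∈ Icc 0 1 from ⟨by linarith, by linarith [hx.1]⟩)
        (show -y ∈ Icc 0 1 from ⟨by linarith, by linarith [hy.1]⟩) hxy))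
    (by rw [e₁ _ (by norm_num)]; exact h₁.ne_zero hf (s := - -(1 / 2)) (by norm_num))
  -- A hyperbola is a single trajectory, so it passes both windows in the same sense of `w`.
  have hleaf : ∀ᶠ c in 𝓝[>] (0 : ℝ),
      (Joins f (fun w => Φ (c, w)) (1 / 2) t₀ ∧ Joins f (fun w => Φ (c, w)) (-(1 / 2)) t₁) ∨
      (Joins f (fun w => Φ (c, w)) t₀ (1 / 2) ∧ Joins f (fun w => Φ (c, w)) t₁ (-(1 / 2))) := by
    filter_upwards [Ioo_mem_nhdsGT (show (0 : ℝ) < 1 / 4 by norm_num)] with c hc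
    have hcl : ∀ w ∈ Icc (-(3 / 4) : ℝ) (3 / 4), w ∈ Icc (-(1 - c)) (1 - c) := fun w hw =>
      ⟨by linarith [hw.1, hc.2], by linarith [hw.2, hc.2]⟩
    have m1 := hcl (1 / 2) (by norm_num)
    have m2 := hcl (-(1 / 2)) (by norm_num)
    have m3 := hcl t₀ ⟨by linarith, by linarith⟩
    have m4 := hcl t₁ ⟨by linarith, by linarith⟩
    exact ((h.isTrajectoryArc_hyperbola hφ hc.1 (by linarith [hc.2])).flowsUp_or_flowsDown hf).imp
      (fun hu => ⟨hu _ m1 _ m3 ht₀, hu _ m2 _ m4 ht₁⟩)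
      (fun hu => ⟨hu _ m1 _ m3 ht₀, hu _ m2 _ m4 ht₁⟩)
  have r₀ : ∀ s t, 0 ≤ s → 0 ≤ t → Joins f (fun w => φ (w, 0)) s t →
      Joins f (fun w => Φ (0, w)) s t := fun s t hs ht hj =>
    hj.reparam (g := id) (fun w hw => (e₀ w ((le_inf hs ht).trans hw.1)).symm) (mapsTo_id _)
  -- On the second side the parameter is `-w`, so moving away from the vertex means that `w`
  -- decreases.
  have r₁ : ∀ s t, s ≤ 0 → t ≤ 0 → Joins f (fun w => φ (0, w)) (-s) (-t) →
      Joins f (fun w => Φ (0, w)) s t := fun s t hs ht hj => by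
    have := hj.reparam (β' := fun w => Φ (0, w)) (g := fun w => -w) (fun w hw => by
      have : 0 ≤ w := (le_inf (by linarith) (by linarith)).trans hw.1
      simp only [e₁ (-w) (by linarith), neg_neg]) (fun w hw => by
      rw [mem_uIcc] at hw ⊢
      grind)
    simpa using this
  have i₁ : -t₁ ∈ Ioc (0 : ℝ) 1 := ⟨by linarith, by linarith⟩
  have i₀ : t₀ ∈ Ioc (0 : ℝ) 1 := ⟨by linarith, by linarith⟩
  have i₂ : (1 / 2 : ℝ) ∈ Ioc (0 : ℝ) 1 := by norm_num
  have i₃ : (- -(1 / 2) : ℝ) ∈ Ioc (0 : ℝ) 1 := by norm_num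
  have hlt : -t₁ < - -(1 / 2) := by linarith
  -- If both sides were outgoing, or both incoming, then `w` would change in opposite senses in the
  -- two windows, against `hleaf` for small `c`.
  rcases h₀.flowsUp_or_flowsDown hf with u₀ | u₀ <;>
    rcases h₁.flowsUp_or_flowsDown hf with u₁ | u₁
  · have a₀ := hup₀ (r₀ _ _ (by norm_num) i₀.1.le (u₀ _ i₂ _ i₀ ht₀))
    have a₁ := hdown₁ (r₁ _ _ (by linarith) (by norm_num) (u₁ _ i₁ _ i₃ hlt))
    obtain ⟨c, b₀, b₁, b⟩ := (a₀.and (a₁.and hleaf)).exists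
    exact absurd b (by tauto)
  · exact Or.inl ⟨u₀, u₁⟩
  · exact Or.inr ⟨u₀, u₁⟩
  · have a₀ := hdown₀ (r₀ _ _ i₀.1.le (by norm_num) (u₀ _ i₂ _ i₀ ht₀))
    have a₁ := hup₁ (r₁ _ _ (by norm_num) (by linarith) (u₁ _ i₁ _ i₃ hlt))
    obtain ⟨c, b₀, b₁, b⟩ := (a₀.and (a₁.and hleaf)).exists
    exact absurd b (by tauto)

/-! ### Outgoing and incoming sides, and the parity count -/

/-- `α` parametrizes the arc `A` issuing from `x₀`, which without `x₀` has no equilibria of `f`. -/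
structure IsRegularArc (f : E → E) (x₀ : E) (A : Set E) (α : ℝ → E) : Prop where
  continuousOn : ContinuousOn α (Icc 0 1)
  injOn : InjOn α (Icc 0 1)
  map_zero : α 0 = x₀
  image_eq : α '' Icc 0 1 = A
  ne_zero : ∀ w ∈ Ioc 0 1, f (α w) ≠ 0

/-- The flow along the arc `A` is directed away from its end `x₀`. -/
def IsOutgoing (f : E → E) (x₀ : E) (A : Set E) : Prop :=
  ∃ α, IsRegularArc f x₀ A α ∧ FlowsUp f α (Ioc 0 1)

/-- The flow along the arc `A` is directed towards its end `x₀`. -/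
def IsIncoming (f : E → E) (x₀ : E) (A : Set E) : Prop :=
  ∃ α, IsRegularArc f x₀ A α ∧ FlowsDown f α (Ioc 0 1)

/-- The charts of two adjacent sectors may parametrize their common side differently. The change of
parameter is continuous, injective and fixes `0`, hence is increasing and preserves directions. -/
theorem IsOutgoing.not_isIncoming (hf : Continuous f) (ho : IsOutgoing f x₀ A) :
    ¬ IsIncoming f x₀ A := by
  rintro ⟨β, hβ, hdown⟩
  obtain ⟨α, hα, hup⟩ := ho
  obtain ⟨g, hgc, hg⟩ := exists_continuousOn_lift isCompact_Icc hα.continuousOn hα.injOn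
    hβ.continuousOn fun τ hτ => by rw [hα.image_eq, ← hβ.image_eq]; exact mem_image_of_mem β hτ
  have h0 : (0 : ℝ) ∈ Icc (0 : ℝ) 1 := by norm_num
  have h1 : (1 : ℝ) ∈ Icc (0 : ℝ) 1 := by norm_num
  have h2 : (1 / 2 : ℝ) ∈ Icc (0 : ℝ) 1 := by norm_num
  have hinj : InjOn g (Icc 0 1) := fun x hx y hy hxy =>
    hβ.injOn hx hy (by rw [← (hg x hx).2, ← (hg y hy).2, hxy])
  have hg0 : g 0 = 0 := hα.injOn (hg 0 h0).1 h0 (by rw [(hg 0 h0).2, hα.map_zero, hβ.map_zero])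
  have hmono : StrictMonoOn g (Icc 0 1) := by
    refine hgc.strictMonoOn_of_injOn_Icc zero_le_one ?_ hinj
    rw [hg0]; exact (hg 1 h1).1.1
  have hlt : g (1 / 2) < g 1 := hmono h2 h1 (by norm_num)
  have hpos : 0 < g (1 / 2) := hg0 ▸ hmono h0 h2 (by norm_num)
  have hle : g 1 ≤ 1 := (hg 1 h1).1.2
  -- The comparison is made away from parameter `0`, since `Joins.not_symm` needs a piece without
  -- equilibria.
  have hsub : Icc (g (1 / 2)) (g 1) ⊆ Ioc 0 1 := fun w hw =>
    ⟨hpos.trans_le hw.1, hw.2.trans hle⟩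
  have hj := hdown (1 / 2) (by norm_num) 1 (by norm_num) (by norm_num)
  have hu : uIcc (1 : ℝ) (1 / 2) = Icc (1 / 2) 1 := uIcc_of_ge (by norm_num)
  have hu' : Icc (1 / 2 : ℝ) 1 ⊆ Icc 0 1 := Icc_subset_Icc (by norm_num) le_rfl
  have hj' : Joins f α (g 1) (g (1 / 2)) := by
    refine hj.reparam (fun w hw => ?_) fun w hw => ?_
    · rw [hu] at hw
      exact (hg w (hu' hw)).2.symm
    · rw [hu] at hw
      rw [uIcc_of_ge hlt.le]
      exact ⟨hmono.monotoneOn h2 (hu' hw) hw.1, hmono.monotoneOn (hu' hw) h1 hw.2⟩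
  exact (hup _ (hsub ⟨le_rfl, hlt.le⟩) _ (hsub ⟨hlt.le, le_rfl⟩) hlt).not_symm hf hlt
    (hα.continuousOn.mono (hsub.trans Ioc_subset_Icc_self))
    (hα.injOn.mono (hsub.trans Ioc_subset_Icc_self)) (fun w hw => hα.ne_zero w (hsub hw)) hj'

theorem IsHyperbolicSector.isOutgoing_and_isIncoming_or (hf : ContDiff ℝ 1 f)
    (h : IsHyperbolicSector f x₀ S A B) :
    (IsOutgoing f x₀ A ∧ IsIncoming f x₀ B) ∨ (IsIncoming f x₀ A ∧ IsOutgoing f x₀ B) := by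
  obtain ⟨φ, h, hφ⟩ := h
  have hA : IsRegularArc f x₀ A fun w => φ (w, 0) :=
    ⟨h.continuousOn_side₀, h.injOn_side₀, h.map_vertex, by
      rw [← h.image_side₀, modelSide₀, prod_singleton, image_image],
      fun w hw => (h.isTrajectoryArc_side₀ hφ).ne_zero hf hw⟩
  have hB : IsRegularArc f x₀ B fun w => φ (0, w) :=
    ⟨h.continuousOn_side₁, h.injOn_side₁, h.map_vertex, by
      rw [← h.image_side₁, modelSide₁, singleton_prod, image_image],
      fun w hw => (h.isTrajectoryArc_side₁ hφ).ne_zero hf hw⟩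
  exact (h.flowsUp_and_flowsDown_or hf hφ).imp (fun k => ⟨⟨_, hA, k.1⟩, ⟨_, hB, k.2⟩⟩)
    (fun k => ⟨⟨_, hA, k.1⟩, ⟨_, hB, k.2⟩⟩)

/-- If all the sectors around `x₀` are hyperbolic, their number is even. -/
theorem SectorDecomposition.exists_not_isHyperbolicSector (hf : ContDiff ℝ 1 f) {n : ℕ}
    (hn : Odd n) (D : SectorDecomposition x₀ n) :
    ∃ i, ¬ IsHyperbolicSector f x₀ (D.sector i) (D.side i) (D.side (i + 1)) := by
  by_contra! hall
  have step : ∀ i, IsOutgoing f x₀ (D.side (i + 1)) ↔ ¬ IsOutgoing f x₀ (D.side i) := by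
    intro i
    have hx := fun j => IsOutgoing.not_isIncoming (x₀ := x₀) (A := D.side j) hf.continuous
    rcases (hall i).isOutgoing_and_isIncoming_or hf with ⟨h1, h2⟩ | ⟨h1, h2⟩
    · exact ⟨fun h => absurd h2 (hx _ h), fun h => absurd h1 h⟩
    · exact ⟨fun _ h => hx _ h h1, fun _ => h2⟩
  -- `k` is a natural number cast to `ZMod n`; at `k = n` the side is `side 0` again, which forces
  -- `n` to be even. For `n = 1` this says that the one arc cannot be both outgoing and not
  -- outgoing.
  have parity : ∀ k : ℕ, IsOutgoing f x₀ (D.side k) ↔ (IsOutgoing f x₀ (D.side 0) ↔ Even k) := by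
    intro k
    induction k with
    | zero => simp
    | succ k ih => rw [Nat.cast_succ, step, ih, Nat.even_add_one]; tauto
  have := parity n
  rw [ZMod.natCast_self, ← Nat.not_odd_iff_even] at this
  tauto

end HyperbolicSector

theorem mainTheorem1
    (f : EuclideanSpace ℝ (Fin 2) → EuclideanSpace ℝ (Fin 2)) (hf : ContDiff ℝ 1 f)
    (x₀ : EuclideanSpace ℝ (Fin 2)) (hx₀ : f x₀ = 0) :
    (∀ n : ℕ, Odd n → ∀ D : SectorDecomposition x₀ n,
      ∃ i, ¬ IsHyperbolicSector f x₀ (D.sector i) (D.side i) (D.side (i + 1))) ∧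
    ¬ IsDelta f x₀ := by
  refine ⟨fun n hn D => D.exists_not_isHyperbolicSector hf hn, ?_⟩
  rintro ⟨D, hD⟩
  obtain ⟨i, hi⟩ := D.exists_not_isHyperbolicSector hf (by decide)
  exact hi (hD i)
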